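/- Proposition 5.7. Let $\mathbf I$ be a finitely generated, connected, upward-simply-connected category, and let $\mathbf C$ be a category with the amalgamation property. Then every functor $F:\mathbf I\to\mathbf C$ has a cocone, i.e. there are an object $X$ of $\mathbf C$ and morphisms $f_I:F(I)\to X$ for all objects $I$ of $\mathbf I$ such that $f_I=f_J\circ F(i)$ for every $i:I\to J$ in $\mathbf I$. Here: - $\mathbf I$ is *finitely generated* if there are finitely many arrows of $\mathbf I$ whose closure under (binary) composition consists of all arrows of $\mathbf I$, identities included; so $\mathbf I$ has finitely many objects. - $\mathbf I$ is *connected* if it is non-empty and any two objects are joined by a zigzag of morphisms. - $\mathbf C$ has the *amalgamation property* (AP) if every diagram of shape $\bullet\leftarrow\bullet\rightarrow\bullet$ in $\mathbf C$ has a cocone. - An *inverse category* is a category in which every morphism $f:X\to Y$ has a unique pseudoinverse $f^{-1}:Y\to X$, i.e. a morphism with $f\circ f^{-1}\circ f=f$ and $f^{-1}\circ f\circ f^{-1}=f^{-1}$. - The *left fundamental inverse category* $\mathcal L(\mathbf I)$ is the inverse category freely generated by $\mathbf I$ such that every morphism of $\mathbf I$ becomes monic: there is a functor $\eta:\mathbf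 I\to\mathcal L(\mathbf I)$ with $\eta(i)^{-1}\circ\eta(i)=1$ for all arrows $i$ of $\mathbf I$, and every functor $G$ from $\mathbf I$ to an inverse category with $G(i)^{-1}\circ G(i)=1$ for all $i$ factors uniquely through $\eta$. - $\mathbf I$ is *upward-simply-connected* if $\mathcal L(\mathbf I)$ is idempotent, i.e. $f\circ f=f$ for every endomorphism $f$ in $\mathcal L(\mathbf I)$. -/

import Mathlib

open CategoryTheory

universe v u v' u'

/-- The closure of a set of arrows under binary composition. -/
inductive ArrowClosure {I : Type u} [Category.{v} I] (S : Set (Arrow I)) :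
    ∀ {X Y : I}, (X ⟶ Y) → Prop
  | of {X Y : I} (f : X ⟶ Y) (hf : Arrow.mk f ∈ S) : ArrowClosure S f
  | comp {X Y Z : I} (f : X ⟶ Y) (g : Y ⟶ Z) (hf : ArrowClosure S f) (hg : ArrowClosure S g) :
      ArrowClosure S (f ≫ g)

/-- A category is finitely generated if there are finitely many arrows whose closure under binary
composition consists of all arrows.  Identities are not included for free, so that a finitely
generated category has only finitely many objects. -/
def FinitelyGeneratedCategory (I : Type u) [Category.{v} I] : Prop :=
  ∃ S : Set (Arrow I), S.Finite ∧ ∀ (X Y : I) (f : X ⟶ Y), ArrowClosure S f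

/-- The amalgamation property: every diagram of shape `• ⟵ • ⟶ •` has a cocone. -/
def AmalgamationProperty (C : Type u) [Category.{v} C] : Prop :=
  ∀ F : Limits.WalkingSpan ⥤ C, Nonempty (Limits.Cocone F)

/-- A category is idempotent if each of its endomorphisms is idempotent. -/
def IdempotentCategory (C : Type u) [Category.{v} C] : Prop :=
  ∀ (X : C) (f : X ⟶ X), f ≫ f = f

/-- `g` is a pseudoinverse of `f`. -/
def IsPseudoinverse {C : Type u} [Category.{v} C] {X Y : C} (f : X ⟶ Y) (g : Y ⟶ X) : Prop :=
  f ≫ g ≫ f = f ∧ g ≫ f ≫ g = g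

/-- An inverse category: every morphism has a unique pseudoinverse. -/
def InverseCategory (C : Type u) [Category.{v} C] : Prop :=
  ∀ (X Y : C) (f : X ⟶ Y), ∃! g : Y ⟶ X, IsPseudoinverse f g

/-! ### The left fundamental inverse category

It is built as the free algebra: formal words in the arrows of `I`, identities, composites and
pseudoinverses, modulo the least congruence which forces exactly the axioms. -/

/-- Formal words over `I`, with composition in diagrammatic order. -/
inductive LWord (I : Type u) [Category.{v} I] : I → I → Type (max u v)
  | of {X Y : I} (i : X ⟶ Y) : LWord I X Y
  | id (X : I) : LWord I X X
  | comp {X Y Z : I} (f : LWord I X Y) (g : LWord I Y Z) : LWord I X Z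
  | inv {X Y : I} (f : LWord I X Y) : LWord I Y X

/-- The least congruence on formal words such that the quotient is an inverse category in which
`inv` gives the pseudoinverses, `of` is functorial, and `of i` followed by `inv (of i)` is an
identity for every arrow `i` of `I`. -/
inductive LRel (I : Type u) [Category.{v} I] : ∀ {X Y : I}, LWord I X Y → LWord I X Y → Prop
  | refl {X Y : I} (f : LWord I X Y) : LRel I f f
  | symm {X Y : I} {f g : LWord I X Y} : LRel I f g → LRel I g f
  | trans {X Y : I} {f g h : LWord I X Y} : LRel I f g → LRel I g h → LRel I f h
  | comp {X Y Z : I} {f f' : LWord I X Y} {g g' : LWord I Y Z} :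
      LRel I f f' → LRel I g g' → LRel I (f.comp g) (f'.comp g')
  | id_comp {X Y : I} (f : LWord I X Y) : LRel I ((LWord.id X).comp f) f
  | comp_id {X Y : I} (f : LWord I X Y) : LRel I (f.comp (LWord.id Y)) f
  | assoc {W X Y Z : I} (f : LWord I W X) (g : LWord I X Y) (h : LWord I Y Z) :
      LRel I ((f.comp g).comp h) (f.comp (g.comp h))
  | of_id (X : I) : LRel I (LWord.of (𝟙 X)) (LWord.id X)
  | of_comp {X Y Z : I} (i : X ⟶ Y) (j : Y ⟶ Z) :
      LRel I (LWord.of (i ≫ j)) ((LWord.of i).comp (LWord.of j))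
  | comp_inv_comp {X Y : I} (f : LWord I X Y) : LRel I (f.comp (f.inv.comp f)) f
  | inv_comp_inv {X Y : I} (f : LWord I X Y) : LRel I (f.inv.comp (f.comp f.inv)) f.inv
  | inv_unique {X Y : I} (f : LWord I X Y) (g : LWord I Y X) :
      LRel I (f.comp (g.comp f)) f → LRel I (g.comp (f.comp g)) g → LRel I g f.inv
  | monic {X Y : I} (i : X ⟶ Y) :
      LRel I ((LWord.of i).comp (LWord.of i).inv) (LWord.id X)

/-- The congruence `LRel` as a setoid. -/
def LSetoid (I : Type u) [Category.{v} I] (X Y : I) : Setoid (LWord I X Y) :=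
  ⟨LRel I, LRel.refl, LRel.symm, LRel.trans⟩

/-- The left fundamental inverse category of `I`: it has the same objects as `I`. -/
structure LeftFundamental (I : Type u) where
  of ::
  /-- The underlying object of `I`. -/
  as : I

namespace LeftFundamental

instance category (I : Type u) [Category.{v} I] :
    Category.{max u v} (LeftFundamental I) where
  Hom X Y := Quotient (LSetoid I X.as Y.as)
  id X := Quotient.mk _ (LWord.id X.as)
  comp := fun f g => Quotient.map₂ LWord.comp (fun _ _ h _ _ h' => LRel.comp h h') f g
  id_comp := by
    rintro X Y ⟨f⟩
    exact Quotient.sound (LRel.id_comp f)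
  comp_id := by
    rintro X Y ⟨f⟩
    exact Quotient.sound (LRel.comp_id f)
  assoc := by
    rintro W X Y Z ⟨f⟩ ⟨g⟩ ⟨h⟩
    exact Quotient.sound (LRel.assoc f g h)

/-- The class of a formal word. -/
def mk {I : Type u} [Category.{v} I] {X Y : I} (w : LWord I X Y) :
    LeftFundamental.of X ⟶ LeftFundamental.of Y :=
  Quotient.mk (LSetoid I X Y) w

/-- The canonical functor from `I` to its left fundamental inverse category. -/
def η (I : Type u) [Category.{v} I] : I ⥤ LeftFundamental I where
  obj X := ⟨X⟩
  map i := mk (LWord.of i)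
  map_id X := Quotient.sound (LRel.of_id X)
  map_comp i j := Quotient.sound (LRel.of_comp i j)


/-- The left fundamental inverse category is an inverse category. -/
theorem inverseCategory (I : Type u) [Category.{v} I] : InverseCategory (LeftFundamental I) := by
  rintro ⟨X⟩ ⟨Y⟩ f
  induction f using Quotient.inductionOn with
  | _ f =>
    refine ⟨mk f.inv, ⟨Quotient.sound (LRel.comp_inv_comp f),
      Quotient.sound (LRel.inv_comp_inv f)⟩, ?_⟩
    intro g
    induction g using Quotient.inductionOn with
    | _ g =>
      rintro ⟨h₁, h₂⟩
      exact Quotient.sound (LRel.inv_unique f g (Quotient.exact h₁) (Quotient.exact h₂))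

/-- Every arrow of `I` becomes monic: its image followed by the pseudoinverse is an identity. -/
theorem η_monic {I : Type u} [Category.{v} I] {X Y : I} (i : X ⟶ Y)
    (g : (η I).obj Y ⟶ (η I).obj X) (hg : IsPseudoinverse ((η I).map i) g) :
    (η I).map i ≫ g = 𝟙 _ := by
  have h : g = mk (LWord.of i).inv := (inverseCategory I _ _ ((η I).map i)).unique hg
    ⟨Quotient.sound (LRel.comp_inv_comp _), Quotient.sound (LRel.inv_comp_inv _)⟩
  subst h
  exact Quotient.sound (LRel.monic i)

/-- Evaluation of a formal word in an inverse category. -/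
noncomputable def eval {I : Type u} [Category.{v} I] {D : Type u'} [Category.{v'} D]
    (hD : InverseCategory D) (F : I ⥤ D) : ∀ {X Y : I}, LWord I X Y → (F.obj X ⟶ F.obj Y)
  | _, _, .of i => F.map i
  | _, _, .id X => 𝟙 (F.obj X)
  | _, _, .comp f g => eval hD F f ≫ eval hD F g
  | _, _, .inv f => (hD _ _ (eval hD F f)).choose

theorem eval_eq {I : Type u} [Category.{v} I] {D : Type u'} [Category.{v'} D]
    (hD : InverseCategory D) (F : I ⥤ D)
    (hF : ∀ {X Y : I} (i : X ⟶ Y) (g : F.obj Y ⟶ F.obj X),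
      IsPseudoinverse (F.map i) g → F.map i ≫ g = 𝟙 _)
    {X Y : I} {f g : LWord I X Y} (h : LRel I f g) : eval hD F f = eval hD F g := by
  induction h with
  | refl => rfl
  | symm _ ih => exact ih.symm
  | trans _ _ ih ih' => exact ih.trans ih'
  | comp _ _ ih ih' => simp only [eval, ih, ih']
  | id_comp => simp [eval]
  | comp_id => simp [eval]
  | assoc => simp [eval]
  | of_id => simp [eval]
  | of_comp => simp [eval]
  | comp_inv_comp f => exact (hD _ _ (eval hD F f)).choose_spec.1.1
  | inv_comp_inv f => exact (hD _ _ (eval hD F f)).choose_spec.1.2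
  | inv_unique f g _ _ ih ih' => exact (hD _ _ (eval hD F f)).choose_spec.2 _ ⟨ih, ih'⟩
  | monic i => exact hF i _ (hD _ _ (F.map i)).choose_spec.1

/-- The universal property: a functor from `I` to an inverse category, every value `F i` of which
is monic (that is, `F i` followed by its pseudoinverse is an identity), factors uniquely through
the canonical functor. -/
theorem existsUnique_lift {I : Type u} [Category.{v} I] {D : Type u'} [Category.{v'} D]
    (hD : InverseCategory D) (F : I ⥤ D)
    (hF : ∀ {X Y : I} (i : X ⟶ Y) (g : F.obj Y ⟶ F.obj X),
      IsPseudoinverse (F.map i) g → F.map i ≫ g = 𝟙 _) :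
    ∃! G : LeftFundamental I ⥤ D, η I ⋙ G = F := by
  let G : LeftFundamental I ⥤ D :=
    { obj := fun X => F.obj X.as
      map := fun f => Quotient.lift (eval hD F) (fun _ _ h => eval_eq hD F hF h) f
      map_id := fun _ => rfl
      map_comp := by
        rintro X Y Z ⟨f⟩ ⟨g⟩
        rfl }
  refine ⟨G, rfl, ?_⟩
  rintro G' rfl
  have key : ∀ {X Y : I} (w : LWord I X Y), G'.map (mk w) = eval hD (η I ⋙ G') w := by
    intro X Y w
    induction w with
    | of i => rfl
    | id X => exact G'.map_id _
    | comp f g ih ih' =>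
      exact (G'.map_comp (mk f) (mk g)).trans (by rw [ih, ih']; rfl)
    | inv f ih =>
      refine (hD _ _ (eval hD (η I ⋙ G') f)).choose_spec.2 _ ?_
      have h₁ : mk f ≫ mk f.inv ≫ mk f = mk f := Quotient.sound (LRel.comp_inv_comp f)
      have h₂ : mk f.inv ≫ mk f ≫ mk f.inv = mk f.inv := Quotient.sound (LRel.inv_comp_inv f)
      rw [← ih]
      constructor
      · have e := congrArg (fun t => G'.map t) h₁
        simp only [Functor.map_comp] at e
        exact e
      · have e := congrArg (fun t => G'.map t) h₂
        simp only [Functor.map_comp] at e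
        exact e
  refine CategoryTheory.Functor.hext (fun _ => rfl) ?_
  rintro ⟨X⟩ ⟨Y⟩ ⟨w⟩
  exact heq_of_eq (key w)

end LeftFundamental

/-- A category is upward-simply-connected if its left fundamental inverse category is
idempotent. -/
def UpwardSimplyConnected (I : Type u) [Category.{v} I] : Prop :=
  IdempotentCategory (LeftFundamental I)

-- Induct on the size of an upward closed connected set `U` of objects. Let `x` be minimal in `U`
-- and discard the objects of `U` with an arrow to `x`. What remains is upward closed, each of its
-- components has a cocone by induction, and each component contains an object strictly above `x`.
-- Choose one arrow from `x` into each component and amalgamate the cocones over `F x`. The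
-- resulting maps are compatible up to `EventuallyEq`, and finite generation leaves finitely many
-- equalities to be made true by one further arrow.
--
-- Upward simple connectedness enters through `UpwardSimplyConnected.eq_of_eqvGen`: a functor to
-- types with injective transition maps acts on formal words by partial injections, and idempotent
-- partial injections move no point. Applied to arrows modulo eventual equality, this makes parallel
-- arrows eventually equal. Applied to a twisted double cover, it shows that each component has a
-- connected part strictly above `x`, so the choice of arrow from `x` does not matter.

universe w

/-! ### Partial injections -/

theorem PEquiv.ext_mem {α : Type u} {β : Type v} {f g : α ≃. β} (h : ∀ a b, b ∈ f a ↔ b ∈ g a) :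
    f = g :=
  PEquiv.ext fun a => Option.ext fun b => h a b

/-- Types, regarded as the objects of the category of partial injections. -/
structure PartialInjCat : Type (w + 1) where
  /-- The underlying type. -/
  carrier : Type w

namespace PartialInjCat

instance category : Category.{w} PartialInjCat.{w} where
  Hom X Y := X.carrier ≃. Y.carrier
  id X := PEquiv.refl X.carrier
  comp f g := PEquiv.trans f g
  id_comp f := PEquiv.refl_trans f
  comp_id f := PEquiv.trans_refl f
  assoc f g h := PEquiv.trans_assoc f g h

theorem isPseudoinverse_symm {X Y : PartialInjCat.{w}} (f : X ⟶ Y) :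
    IsPseudoinverse f (PEquiv.symm f : Y.carrier ≃. X.carrier) := by
  constructor
  · refine PEquiv.ext_mem fun x y => ?_
    change y ∈ (PEquiv.trans f (PEquiv.trans (PEquiv.symm f) f)) x ↔ _
    simp only [PEquiv.mem_trans, PEquiv.mem_iff_mem]
    exact ⟨fun ⟨b, hb, c, hc, h⟩ => by rwa [PEquiv.inj f hb hc],
      fun h => ⟨y, h, x, h, h⟩⟩
  · refine PEquiv.ext_mem fun y x => ?_
    change x ∈ (PEquiv.trans (PEquiv.symm f) (PEquiv.trans f (PEquiv.symm f))) y ↔ _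
    simp only [PEquiv.mem_trans, PEquiv.mem_iff_mem]
    exact ⟨fun ⟨b, hb, c, hc, h⟩ => by
      rw [Option.mem_def] at *; rw [hb] at hc; cases hc; exact h,
      fun h => ⟨x, h, y, h, h⟩⟩

theorem inverseCategory : InverseCategory PartialInjCat.{w} := by
  intro X Y f
  refine ⟨PEquiv.symm f, isPseudoinverse_symm f, ?_⟩
  · rintro g ⟨h₁, h₂⟩
    refine PEquiv.ext_mem fun y x => ?_
    rw [PEquiv.mem_iff_mem]
    constructor
    · intro h
      have h' := h
      rw [← h₂] at h
      change x ∈ (PEquiv.trans g (PEquiv.trans f g)) y at h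
      simp only [PEquiv.mem_trans] at h
      obtain ⟨b, hb, c, hc, h⟩ := h
      -- In the chain y ↦ b ↦ c ↦ x, injectivity of `g` gives c = y and single-valuedness gives b =
      -- x.
      rw [PEquiv.inj g h' h]
      rw [Option.mem_def] at *
      rw [hb] at h'
      cases h'
      exact hc
    · intro h
      have h' := h
      rw [← h₁] at h
      change y ∈ (PEquiv.trans f (PEquiv.trans g f)) x at h
      simp only [PEquiv.mem_trans] at h
      obtain ⟨b, hb, c, hc, h⟩ := h
      rw [PEquiv.inj f h' h]
      rw [Option.mem_def] at *
      rw [hb] at h'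
      cases h'
      exact hc

open Classical in
/-- An injective function as a partial injection. -/
noncomputable def ofInjective {α β : Type w} (f : α → β) (hf : Function.Injective f) : α ≃. β where
  toFun a := some (f a)
  invFun b := if h : ∃ a, f a = b then some h.choose else none
  inv a b := by
    by_cases h : ∃ a, f a = b
    · simp only [h, dite_true, Option.some.injEq]
      refine ⟨fun e => e ▸ h.choose_spec, fun e => hf (h.choose_spec.trans e.symm)⟩
    · simp only [h, dite_false, Option.some.injEq]
      exact ⟨fun e => (Option.some_ne_none _ e.symm).elim, fun e => (h ⟨a, e⟩).elim⟩

theorem ofInjective_apply {α β : Type w} (f : α → β) (hf : Function.Injective f) (a : α) :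
    ofInjective f hf a = some (f a) := rfl

/-- Since `f` is total and injective, one pseudoinverse identity already forces `g` to undo `f` on
its range. -/
theorem ofInjective_trans_eq_refl {α β : Type w} (f : α → β) (hf : Function.Injective f)
    (g : β ≃. α)
    (h : (ofInjective f hf).trans (g.trans (ofInjective f hf)) = ofInjective f hf) :
    (ofInjective f hf).trans g = PEquiv.refl α := by
  have key : ∀ a, g (f a) = some a := by
    intro a
    have h₁ : f a ∈ (ofInjective f hf).trans (g.trans (ofInjective f hf)) a := by
      rw [h]
      rfl
    obtain ⟨b, hb, c, hc, hc'⟩ := by simpa only [PEquiv.mem_trans] using h₁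
    cases Option.some.inj hb
    cases hf (Option.some.inj hc')
    exact hc
  refine PEquiv.ext_mem fun a b => ?_
  rw [PEquiv.mem_trans, PEquiv.refl_apply]
  constructor
  · rintro ⟨c, hc, hc'⟩
    cases Option.some.inj hc
    exact (key a).symm.trans hc'
  · exact fun h => ⟨f a, rfl, (key a).trans h⟩

/-- A functor to types with injective transition maps, as a functor to partial injections. -/
noncomputable def ofFunctor {I : Type u} [Category.{v} I] (G : I ⥤ Type w)
    (hG : ∀ {X Y : I} (i : X ⟶ Y), Function.Injective (G.map i)) : I ⥤ PartialInjCat.{w} where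
  obj X := ⟨G.obj X⟩
  map i := ofInjective (G.map i) (hG i)
  map_id X := by
    refine PEquiv.ext fun a => ?_
    rw [ofInjective_apply]
    simp
    rfl
  map_comp i j := by
    refine PEquiv.ext fun a => ?_
    rw [ofInjective_apply]
    simp
    rfl

end PartialInjCat

/-! ### Absence of monodromy -/

section Monodromy

variable {I : Type u} [Category.{v} I]

/-- One element of a functor to types is mapped to another one by a transition map. -/
def ElementStep (G : I ⥤ Type w) (p q : Σ X, G.obj X) : Prop :=
  ∃ i : p.1 ⟶ q.1, G.map i p.2 = q.2

theorem PartialInjCat.ofFunctor_map_comp_pseudoinverse (G : I ⥤ Type w)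
    (hG : ∀ {X Y : I} (i : X ⟶ Y), Function.Injective (G.map i)) {X Y : I} (i : X ⟶ Y)
    (g : (PartialInjCat.ofFunctor G hG).obj Y ⟶ (PartialInjCat.ofFunctor G hG).obj X)
    (hg : IsPseudoinverse ((PartialInjCat.ofFunctor G hG).map i) g) :
    (PartialInjCat.ofFunctor G hG).map i ≫ g = 𝟙 _ :=
  PartialInjCat.ofInjective_trans_eq_refl _ (hG i) _ hg.1

/-- If the left fundamental inverse category is idempotent, then functors to types with injective
transition maps have no monodromy. -/
theorem UpwardSimplyConnected.eq_of_eqvGen (h : UpwardSimplyConnected I) (G : I ⥤ Type w)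
    (hG : ∀ {X Y : I} (i : X ⟶ Y), Function.Injective (G.map i)) {X : I} {a b : G.obj X}
    (hab : Relation.EqvGen (ElementStep G) ⟨X, a⟩ ⟨X, b⟩) : a = b := by
  -- A zigzag of elements is traced by a formal word, evaluated as a partial injection.
  have key : ∀ p q, Relation.EqvGen (ElementStep G) p q → ∃ t : LWord I p.1 q.1,
      q.2 ∈ (show G.obj p.1 ≃. G.obj q.1 from LeftFundamental.eval PartialInjCat.inverseCategory
        (PartialInjCat.ofFunctor G hG) t) p.2 := by
    intro p q hpq
    induction hpq with
    | rel p q hpq =>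
      obtain ⟨i, hi⟩ := hpq
      exact ⟨.of i, congrArg some hi⟩
    | refl p => exact ⟨.id _, rfl⟩
    | symm p q _ ih =>
      obtain ⟨t, ht⟩ := ih
      refine ⟨.inv t, ?_⟩
      have e : LeftFundamental.eval PartialInjCat.inverseCategory
        (PartialInjCat.ofFunctor G hG) (.inv t) = PEquiv.symm (LeftFundamental.eval
          PartialInjCat.inverseCategory (PartialInjCat.ofFunctor G hG) t) :=
        (PartialInjCat.inverseCategory _ _ _).unique
          (PartialInjCat.inverseCategory _ _ _).choose_spec.1 (PartialInjCat.isPseudoinverse_symm _)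
      rw [e]
      exact (PEquiv.mem_iff_mem _).2 ht
    | trans p q r _ _ ih ih' =>
      obtain ⟨t, ht⟩ := ih
      obtain ⟨t', ht'⟩ := ih'
      exact ⟨.comp t t', (PEquiv.mem_trans _ _ _ _).2 ⟨_, ht, ht'⟩⟩
  obtain ⟨t, ht⟩ := key _ _ hab
  have e := LeftFundamental.eval_eq PartialInjCat.inverseCategory (PartialInjCat.ofFunctor G hG)
    (PartialInjCat.ofFunctor_map_comp_pseudoinverse G hG)
    (Quotient.exact (h ⟨X⟩ (LeftFundamental.mk t)))
  -- Idempotence of `t` with t(a) = b gives t(b) = b, so a = b by injectivity.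
  have ht₂ := ht
  rw [← e] at ht₂
  obtain ⟨c, hc, hc'⟩ := (PEquiv.mem_trans _ _ _ _).1 ht₂
  cases Option.some.inj (ht.symm.trans hc)
  exact PEquiv.inj _ ht hc'

end Monodromy

/-! ### Equality up to extension -/

section EventuallyEq

variable {C : Type u} [Category.{v} C]

/-- Two parallel arrows are eventually equal if, after every arrow out of their target, they can be
made equal by a further arrow. -/
def EventuallyEq {A B : C} (p q : A ⟶ B) : Prop :=
  ∀ ⦃D : C⦄ (h : B ⟶ D), ∃ (E : C) (k : D ⟶ E), p ≫ h ≫ k = q ≫ h ≫ k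

namespace EventuallyEq

theorem refl {A B : C} (p : A ⟶ B) : EventuallyEq p p := fun D _ => ⟨D, 𝟙 D, rfl⟩

theorem symm {A B : C} {p q : A ⟶ B} (h : EventuallyEq p q) : EventuallyEq q p := fun _ g =>
  let ⟨E, k, hk⟩ := h g
  ⟨E, k, hk.symm⟩

theorem trans {A B : C} {p q r : A ⟶ B} (h : EventuallyEq p q) (h' : EventuallyEq q r) :
    EventuallyEq p r := by
  intro D g
  obtain ⟨E, k, hk⟩ := h g
  obtain ⟨E', k', hk'⟩ := h' (g ≫ k)
  refine ⟨E', k ≫ k', ?_⟩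
  have e := hk =≫ k'
  simp only [Category.assoc] at e hk' ⊢
  exact e.trans hk'

theorem comp_right {A B D : C} {p q : A ⟶ B} (h : EventuallyEq p q) (g : B ⟶ D) :
    EventuallyEq (p ≫ g) (q ≫ g) := by
  intro E g'
  obtain ⟨E', k, hk⟩ := h (g ≫ g')
  exact ⟨E', k, by simpa only [Category.assoc] using hk⟩

theorem comp_left {A B D : C} {p q : A ⟶ B} (h : EventuallyEq p q) (g : D ⟶ A) :
    EventuallyEq (g ≫ p) (g ≫ q) := by
  intro E g'
  obtain ⟨E', k, hk⟩ := h g'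
  exact ⟨E', k, by simp only [Category.assoc, hk]⟩

end EventuallyEq

theorem AmalgamationProperty.exists_comp_eq (hC : AmalgamationProperty C) {A B D : C} (f : A ⟶ B)
    (g : A ⟶ D) : ∃ (E : C) (h : B ⟶ E) (k : D ⟶ E), f ≫ h = g ≫ k := by
  obtain ⟨c⟩ := hC (Limits.span f g)
  exact ⟨c.pt, _, _, Limits.PushoutCocone.condition c⟩

/-- Amalgamating a test arrow `f` with `g` reduces testing against `f` to testing after `g`. -/
theorem EventuallyEq.of_comp_right (hC : AmalgamationProperty C) {A B D : C} {p q : A ⟶ B}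
    (g : B ⟶ D) (h : EventuallyEq (p ≫ g) (q ≫ g)) : EventuallyEq p q := by
  intro E f
  obtain ⟨E', h₁, h₂, e⟩ := hC.exists_comp_eq f g
  obtain ⟨E'', k, hk⟩ := h h₂
  refine ⟨E'', h₁ ≫ k, ?_⟩
  simp only [Category.assoc] at hk
  simp only [reassoc_of% e, hk]

/-- Finitely many pairs of eventually equal arrows with a common target can be made equal at the
same time. -/
theorem exists_forall_comp_eq {ι : Type*} [Finite ι] {B : C} (A : ι → C) (p q : ∀ i, A i ⟶ B)
    (h : ∀ i, EventuallyEq (p i) (q i)) : ∃ (D : C) (k : B ⟶ D), ∀ i, p i ≫ k = q i ≫ k := by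
  have key : ∀ s : Set ι, s.Finite → ∃ (D : C) (k : B ⟶ D), ∀ i ∈ s, p i ≫ k = q i ≫ k := by
    intro s hs
    induction s, hs using Set.Finite.induction_on with
    | empty => exact ⟨B, 𝟙 B, by simp⟩
    | @insert i s _ _ ih =>
      obtain ⟨D, k, hk⟩ := ih
      -- Eventual equality can be tested after `k`, so the equalities already obtained survive.
      obtain ⟨E, k', hk'⟩ := h i k
      refine ⟨E, k ≫ k', fun j hj => ?_⟩
      obtain rfl | hj := hj
      · exact hk'
      · simp only [reassoc_of% (hk j hj)]
  obtain ⟨D, k, hk⟩ := key Set.univ Set.finite_univ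
  exact ⟨D, k, fun i => hk i trivial⟩

/-- Finitely many arrows with a common source have a common extension. -/
theorem AmalgamationProperty.exists_wide (hC : AmalgamationProperty C) {ι : Type*} [Finite ι]
    {A : C} (B : ι → C) (f : ∀ i, A ⟶ B i) :
    ∃ (D : C) (t : A ⟶ D) (k : ∀ i, B i ⟶ D), ∀ i, f i ≫ k i = t := by
  have key : ∀ s : Set ι, s.Finite →
      ∃ (D : C) (t : A ⟶ D), ∀ i ∈ s, ∃ k : B i ⟶ D, f i ≫ k = t := by
    intro s hs
    induction s, hs using Set.Finite.induction_on with
    | empty => exact ⟨A, 𝟙 A, by simp⟩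
    | @insert i s _ _ ih =>
      obtain ⟨D, t, ht⟩ := ih
      obtain ⟨E, h, k, e⟩ := hC.exists_comp_eq (f i) t
      refine ⟨E, t ≫ k, fun j hj => ?_⟩
      obtain rfl | hj := hj
      · exact ⟨h, e⟩
      · obtain ⟨l, hl⟩ := ht j hj
        exact ⟨l ≫ k, by simp only [reassoc_of% hl]⟩
  obtain ⟨D, t, ht⟩ := key Set.univ Set.finite_univ
  choose k hk using fun i => ht i trivial
  exact ⟨D, t, k, hk⟩

end EventuallyEq

/-! ### Parallel arrows -/

section Parallel

variable {I : Type u} [Category.{v} I] {C : Type u'} [Category.{v'} C]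

/-- Arrows out of `X`, up to eventual equality of their images. -/
def eventualSetoid (F : I ⥤ C) (X Y : I) : Setoid (X ⟶ Y) where
  r f g := EventuallyEq (F.map f) (F.map g)
  iseqv := ⟨fun _ => .refl _, .symm, .trans⟩

/-- The functor of arrows out of `X`, up to eventual equality of their images. -/
def eventualHom (F : I ⥤ C) (X : I) : I ⥤ Type v where
  obj Y := Quotient (eventualSetoid F X Y)
  map {Y Z} i := TypeCat.ofHom (Quotient.map (fun f => f ≫ i) fun f g (h : EventuallyEq _ _) => by
    change EventuallyEq _ _
    simpa only [F.map_comp] using h.comp_right (F.map i))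
  map_id Y := by
    ext ⟨f⟩
    exact congrArg (Quotient.mk _) (Category.comp_id f)
  map_comp i j := by
    ext ⟨f⟩
    exact congrArg (Quotient.mk _) (Category.assoc f i j).symm

/-- Parallel arrows of an upward-simply-connected category are eventually equal in every category
with the amalgamation property. -/
theorem UpwardSimplyConnected.eventuallyEq_map (h : UpwardSimplyConnected I)
    (hC : AmalgamationProperty C) (F : I ⥤ C) {X Y : I} (f g : X ⟶ Y) :
    EventuallyEq (F.map f) (F.map g) := by
  have hinj : ∀ {Y Z : I} (i : Y ⟶ Z), Function.Injective ((eventualHom F X).map i) := by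
    rintro Y Z i ⟨f⟩ ⟨g⟩ e
    have e' : EventuallyEq (F.map (f ≫ i)) (F.map (g ≫ i)) := Quotient.exact e
    simp only [F.map_comp] at e'
    exact Quotient.sound (EventuallyEq.of_comp_right hC _ e')
  -- The classes of `f` and `g` are both images of the class of the identity, hence joined by a
  -- zigzag.
  have step : ∀ f : X ⟶ Y, ElementStep (eventualHom F X) ⟨X, Quotient.mk _ (𝟙 X)⟩
      ⟨Y, Quotient.mk _ f⟩ := fun f => ⟨f, congrArg (Quotient.mk _) (Category.id_comp f)⟩
  have e := h.eq_of_eqvGen (eventualHom F X) hinj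
    (.trans _ _ _ (.symm _ _ (.rel _ _ (step f))) (.rel _ _ (step g)))
  exact Quotient.exact e

end Parallel

/-! ### Upward closed sets of objects -/

section UpClosed

variable {I : Type u} [Category.{v} I]

/-- A set of objects is upward closed if it contains the target of every arrow with source in it. -/
def UpClosed (U : Set I) : Prop := ∀ ⦃a b : I⦄, (a ⟶ b) → a ∈ U → b ∈ U

/-- Two objects of a set are adjacent if there is an arrow from the first to the second. -/
def AdjIn (U : Set I) (a b : I) : Prop := a ∈ U ∧ b ∈ U ∧ Nonempty (a ⟶ b)

theorem Relation.EqvGen.iff_of_invariant {α : Type*} {r : α → α → Prop} {a b : α}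
    (h : Relation.EqvGen r a b) {P : α → Prop} (hP : ∀ a b, r a b → (P a ↔ P b)) : P a ↔ P b := by
  induction h with
  | rel a b h => exact hP a b h
  | refl => exact Iff.rfl
  | symm _ _ _ ih => exact ih.symm
  | trans _ _ _ _ _ ih ih' => exact ih.trans ih'

/-- The objects of `U` which are not below `x`. -/
def notBelow (U : Set I) (x : I) : Set I := {z | z ∈ U ∧ IsEmpty (z ⟶ x)}

/-- The objects of `U` which are strictly above `x`. -/
def strictlyAbove (U : Set I) (x : I) : Set I := {z | z ∈ notBelow U x ∧ Nonempty (x ⟶ z)}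

theorem UpClosed.upClosed_notBelow {U : Set I} (hU : UpClosed U) (x : I) : UpClosed (notBelow U x) :=
  fun _ _ f h => ⟨hU f h.1, ⟨fun g => h.2.false (f ≫ g)⟩⟩

open Classical in
/-- The indicator of the pairs from `K` to `V`. -/
noncomputable def twist (K V : Set I) (a b : I) : Bool := decide (a ∈ K ∧ b ∈ V)

/-- The functor which is `Bool` on `U` and empty elsewhere, whose transition maps swap the two
values on the arrows from `K` to `V`. -/
noncomputable def twistedDoubleCover (U K V : Set I) (hU : UpClosed U)
    (h : ∀ ⦃a b c : I⦄, (a ⟶ b) → (b ⟶ c) → a ∈ U →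
      xor (twist K V a b) (twist K V b c) = twist K V a c)
    (h' : Disjoint K V) : I ⥤ Type where
  obj X := {_b : Bool // X ∈ U}
  map {X Y} i := TypeCat.ofHom fun b => ⟨xor b.1 (twist K V X Y), hU i b.2⟩
  map_id X := by
    ext b
    have : ¬ (X ∈ K ∧ X ∈ V) := fun hX => Set.disjoint_left.1 h' hX.1 hX.2
    simp [twist, this]
  map_comp {X Y Z} i j := by
    ext b
    simp [← h i j b.2]

/-- Let `x` be minimal in `U`.  Objects strictly above `x` which are connected among the objects not
below `x` are connected among the objects strictly above `x`. -/
theorem UpwardSimplyConnected.eqvGen_strictlyAbove (h : UpwardSimplyConnected I) {U : Set I}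
    (hU : UpClosed U) {x : I} (hx : x ∈ U) (hmin : ∀ z ∈ U, (z ⟶ x) → Nonempty (x ⟶ z)) {y y' : I}
    (hy : y ∈ strictlyAbove U x) (hy' : y' ∈ strictlyAbove U x)
    (hyy' : Relation.EqvGen (AdjIn (notBelow U x)) y y') :
    Relation.EqvGen (AdjIn (strictlyAbove U x)) y y' := by
  by_contra hne
  -- Twist the double cover along the arrows from the class `K` of `x` to the component `V` of `y'`,
  -- which misses `y` by assumption.
  set K : Set I := {z | z ∈ U ∧ Nonempty (z ⟶ x)} with hK
  set V : Set I := {z | z ∈ strictlyAbove U x ∧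
    Relation.EqvGen (AdjIn (strictlyAbove U x)) z y'} with hV
  have hdisj : Disjoint K V := Set.disjoint_left.2 fun z ⟨_, ⟨f⟩⟩ hz => hz.1.1.2.false f
  have hnb : ∀ z ∈ U, z ∉ K → z ∈ notBelow U x := fun z hz hzK =>
    ⟨hz, ⟨fun f => hzK ⟨hz, ⟨f⟩⟩⟩⟩
  -- An arrow leaving `K` lands strictly above `x`; later arrows stay there and cannot cross the
  -- boundary of `V`. No arrow starting outside `K` enters `K`.
  have hcoc : ∀ ⦃a b c : I⦄, (a ⟶ b) → (b ⟶ c) → a ∈ U →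
      xor (twist K V a b) (twist K V b c) = twist K V a c := by
    intro a b c f g ha
    by_cases haK : a ∈ K
    · by_cases hbK : b ∈ K
      · have hbV : b ∉ V := fun hb => Set.disjoint_left.1 hdisj hbK hb
        simp [twist, haK, hbK, hbV]
      · obtain ⟨⟨i⟩⟩ : Nonempty (Nonempty (x ⟶ a)) := ⟨hmin a ha haK.2.some⟩
        have hb : b ∈ strictlyAbove U x := ⟨hnb b (hU f ha) hbK, ⟨i ≫ f⟩⟩
        have hc : c ∈ strictlyAbove U x := ⟨hU.upClosed_notBelow x g hb.1, ⟨i ≫ f ≫ g⟩⟩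
        have hbc : Relation.EqvGen (AdjIn (strictlyAbove U x)) b c := .rel _ _ ⟨hb, hc, ⟨g⟩⟩
        have : b ∈ V ↔ c ∈ V :=
          ⟨fun hb' => ⟨hc, .trans _ _ _ (.symm _ _ hbc) hb'.2⟩,
            fun hc' => ⟨hb, .trans _ _ _ hbc hc'.2⟩⟩
        simp [twist, haK, hbK, this]
    · have hbK : b ∉ K := fun ⟨_, ⟨i⟩⟩ => haK ⟨ha, ⟨f ≫ i⟩⟩
      simp [twist, haK, hbK]
  let G := twistedDoubleCover U K V hU hcoc hdisj
  have hinj : ∀ {X Y : I} (i : X ⟶ Y), Function.Injective (G.map i) := by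
    rintro X Y i ⟨a, ha⟩ ⟨b, hb⟩ e
    have e' : xor a (twist K V X Y) = xor b (twist K V X Y) :=
      congrArg Subtype.val e
    exact Subtype.ext (by simpa using e')
  have hstep : ∀ {X Y : I} (hX : X ∈ U) (hY : Y ∈ U) (i : X ⟶ Y) (a b : Bool),
      xor a (twist K V X Y) = b → ElementStep G ⟨X, a, hX⟩ ⟨Y, b, hY⟩ :=
    fun hX hY i a b e => ⟨i, Subtype.ext e⟩
  have hxK : x ∈ K := ⟨hx, ⟨𝟙 x⟩⟩
  have hyV : y ∉ V := fun hyV => hne hyV.2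
  have hyV' : y' ∈ V := ⟨hy', .refl _⟩
  have h₁ : Relation.EqvGen (ElementStep G) ⟨y, false, hy.1.1⟩ ⟨x, false, hx⟩ :=
    .symm _ _ (.rel _ _ (hstep hx hy.1.1 hy.2.some _ _ (by simp [twist, hyV])))
  have h₂ : Relation.EqvGen (ElementStep G) ⟨x, false, hx⟩ ⟨y', true, hy'.1.1⟩ :=
    .rel _ _ (hstep hx hy'.1.1 hy'.2.some _ _ (by simp [twist, hxK, hyV']))
  have h₃ : ∃ hz : y' ∈ U, Relation.EqvGen (ElementStep G) ⟨y, false, hy.1.1⟩ ⟨y', false, hz⟩ := by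
    refine (hyy'.iff_of_invariant (P := fun z => ∃ hz : z ∈ U,
      Relation.EqvGen (ElementStep G) ⟨y, false, hy.1.1⟩ ⟨z, false, hz⟩) ?_).1 ⟨hy.1.1, .refl _⟩
    rintro a b ⟨ha, hb, ⟨f⟩⟩
    have haK : a ∉ K := fun ⟨_, ⟨g⟩⟩ => ha.2.false g
    have e : Relation.EqvGen (ElementStep G) ⟨a, false, ha.1⟩ ⟨b, false, hb.1⟩ :=
      .rel _ _ (hstep ha.1 hb.1 f _ _ (by simp [twist, haK]))
    exact ⟨fun ⟨_, h⟩ => ⟨hb.1, .trans _ _ _ h e⟩,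
      fun ⟨_, h⟩ => ⟨ha.1, .trans _ _ _ h (.symm _ _ e)⟩⟩
  obtain ⟨_, h₃⟩ := h₃
  -- The loop y', y, x, y' is twisted only on its last leg, so it flips the Boolean.
  have e := h.eq_of_eqvGen G hinj (.trans _ _ _ (.symm _ _ h₃) (.trans _ _ _ h₁ h₂))
  exact Bool.false_ne_true (congrArg Subtype.val e)

/-- Let `U` be connected and `x ∈ U`.  Every object of `U` which is not below `x` is connected, among
these objects, to one which is strictly above `x`. -/
theorem exists_eqvGen_strictlyAbove {U : Set I} {x : I}
    (hconn : ∀ a ∈ U, ∀ b ∈ U, Relation.EqvGen (AdjIn U) a b) (hx : x ∈ U)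
    (hmin : ∀ z ∈ U, (z ⟶ x) → Nonempty (x ⟶ z)) {z : I} (hz : z ∈ notBelow U x) :
    ∃ y ∈ strictlyAbove U x, Relation.EqvGen (AdjIn (notBelow U x)) y z := by
  have key := ((hconn x hx z hz.1).iff_of_invariant (P := fun z => Nonempty (z ⟶ x) ∨
    ∃ y ∈ strictlyAbove U x, Relation.EqvGen (AdjIn (notBelow U x)) y z) ?_).1 (.inl ⟨𝟙 x⟩)
  · exact key.resolve_left fun ⟨f⟩ => hz.2.false f
  · rintro a b ⟨ha, hb, ⟨f⟩⟩
    by_cases hb' : Nonempty (b ⟶ x)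
    · exact ⟨fun _ => .inl hb', fun _ => .inl (hb'.map fun g => f ≫ g)⟩
    have hbn : b ∈ notBelow U x := ⟨hb, not_nonempty_iff.1 hb'⟩
    by_cases ha' : Nonempty (a ⟶ x)
    -- The zigzag leaves the objects below `x` here; minimality gives x ⟶ a ⟶ b, so `b` is strictly
    -- above `x`.
    · refine ⟨fun _ => .inr ⟨b, ⟨hbn, ?_⟩, .refl _⟩, fun _ => .inl ha'⟩
      exact (hmin a ha ha'.some).map fun g => g ≫ f
    have han : a ∈ notBelow U x := ⟨ha, not_nonempty_iff.1 ha'⟩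
    have e : Relation.EqvGen (AdjIn (notBelow U x)) a b := .rel _ _ ⟨han, hbn, ⟨f⟩⟩
    simp only [ha', hb', false_or]
    exact ⟨fun ⟨y, hy, h⟩ => ⟨y, hy, .trans _ _ _ h e⟩,
      fun ⟨y, hy, h⟩ => ⟨y, hy, .trans _ _ _ h (.symm _ _ e)⟩⟩

end UpClosed

/-! ### Cocones -/

section Cocone

variable {I : Type u} [Category.{v} I] {C : Type u'} [Category.{v'} C]

/-- A cocone on the restriction of `F` to the full subcategory on `U` exists. -/
def HasCoconeOn (F : I ⥤ C) (U : Set I) : Prop :=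
  ∃ (A : C) (a : ∀ z, z ∈ U → (F.obj z ⟶ A)),
    ∀ z w (hz : z ∈ U) (hw : w ∈ U) (f : z ⟶ w), F.map f ≫ a w hw = a z hz

/-- Over a finitely generated category, eventual equality suffices to obtain a cocone. -/
theorem HasCoconeOn.of_eventuallyEq (hI : FinitelyGeneratedCategory I) (F : I ⥤ C) {U : Set I}
    (hU : UpClosed U) (A : C) (a : ∀ z, z ∈ U → (F.obj z ⟶ A))
    (ha : ∀ z w (hz : z ∈ U) (hw : w ∈ U) (f : z ⟶ w), EventuallyEq (F.map f ≫ a w hw) (a z hz)) :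
    HasCoconeOn F U := by
  obtain ⟨S, hS, hgen⟩ := hI
  have : Finite {s : S // s.1.left ∈ U} := by
    have := hS.to_subtype
    infer_instance
  -- Only generators with source in `U` are equalized; composites follow because `U` contains every
  -- intermediate object.
  obtain ⟨D, k, hk⟩ := exists_forall_comp_eq (ι := {s : S // s.1.left ∈ U})
    (fun s => F.obj s.1.1.left)
    (fun s => F.map s.1.1.hom ≫ a _ (hU s.1.1.hom s.2)) (fun s => a _ s.2)
    (fun s => ha _ _ _ _ _)
  refine ⟨D, fun z hz => a z hz ≫ k, fun z w hz hw f => ?_⟩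
  induction hgen z w f with
  | @of z w f hf => simpa using hk ⟨⟨Arrow.mk f, hf⟩, hz⟩
  | @comp z y w f g _ _ ih ih' =>
    have hy := hU f hz
    rw [F.map_comp, Category.assoc, ih' hy hw, ih hz hy]

/-- Even an identity is a composite of generators, so every object is the source of one. -/
theorem FinitelyGeneratedCategory.finite (hI : FinitelyGeneratedCategory I) : Finite I := by
  obtain ⟨S, hS, hgen⟩ := hI
  have key : ∀ {X Y : I} (f : X ⟶ Y), ArrowClosure S f → ∃ s ∈ S, s.left = X := by
    intro X Y f hf
    induction hf with
    | of f hf => exact ⟨_, hf, rfl⟩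
    | comp _ _ _ _ ih _ => exact ih
  refine Set.finite_univ_iff.1 ((hS.image fun s => s.left).subset fun X _ => ?_)
  exact key _ (hgen X X (𝟙 X))

/-- Arrows only define a preorder, so minimality is up to objects with arrows both ways; its strict
part is well founded on a finite set. -/
theorem exists_minimal_object [Finite I] {U : Set I} (hne : U.Nonempty) :
    ∃ x ∈ U, ∀ z ∈ U, (z ⟶ x) → Nonempty (x ⟶ z) := by
  let r : I → I → Prop := fun a b => Nonempty (a ⟶ b) ∧ IsEmpty (b ⟶ a)
  have : IsTrans I r := ⟨fun a b c ⟨⟨f⟩, _⟩ ⟨⟨g⟩, h⟩ => ⟨⟨f ≫ g⟩, ⟨fun k => h.false (k ≫ f)⟩⟩⟩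
  have : Std.Irrefl r := ⟨fun a h => h.2.false (𝟙 a)⟩
  obtain ⟨x, hx, hmin⟩ := (Finite.wellFounded_of_trans_of_irrefl r).has_min U hne
  refine ⟨x, hx, fun z hz f => ?_⟩
  by_contra h
  exact hmin z hz ⟨⟨f⟩, not_nonempty_iff.1 h⟩

/-- The connected component of `y` in `W`. -/
def componentIn (W : Set I) (y : I) : Set I := {z | z ∈ W ∧ Relation.EqvGen (AdjIn W) y z}

theorem UpClosed.upClosed_componentIn {W : Set I} (hW : UpClosed W) (y : I) :
    UpClosed (componentIn W y) :=
  fun _ _ f h => ⟨hW f h.1, .trans _ _ _ h.2 (.rel _ _ ⟨h.1, hW f h.1, ⟨f⟩⟩)⟩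

theorem eqvGen_componentIn {W : Set I} {y a b : I} (hy : y ∈ W) (ha : a ∈ componentIn W y)
    (hb : b ∈ componentIn W y) : Relation.EqvGen (AdjIn (componentIn W y)) a b := by
  have key : ∀ z ∈ componentIn W y, Relation.EqvGen (AdjIn (componentIn W y)) y z := by
    intro z hz
    refine ((hz.2.iff_of_invariant (P := fun z => z ∈ componentIn W y ∧
      Relation.EqvGen (AdjIn (componentIn W y)) y z) ?_).1 ⟨⟨hy, .refl _⟩, .refl _⟩).2
    rintro u v ⟨hu, hv, hf⟩
    have e : Relation.EqvGen (AdjIn W) u v := .rel _ _ ⟨hu, hv, hf⟩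
    constructor
    · rintro ⟨hu', h⟩
      have hv' : v ∈ componentIn W y := ⟨hv, .trans _ _ _ hu'.2 e⟩
      exact ⟨hv', .trans _ _ _ h (.rel _ _ ⟨hu', hv', hf⟩)⟩
    · rintro ⟨hv', h⟩
      have hu' : u ∈ componentIn W y := ⟨hu, .trans _ _ _ hv'.2 (.symm _ _ e)⟩
      exact ⟨hu', .trans _ _ _ h (.symm _ _ (.rel _ _ ⟨hu', hv', hf⟩))⟩
  exact .trans _ _ _ (.symm _ _ (key a ha)) (key b hb)

/-- In an upward-simply-connected, finitely generated category, the cocones on the components of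
the complement of a minimal class glue to a cocone. -/
theorem UpwardSimplyConnected.hasCoconeOn_of_components (h : UpwardSimplyConnected I)
    (hI : FinitelyGeneratedCategory I) (hC : AmalgamationProperty C) (F : I ⥤ C) {U : Set I}
    (hU : UpClosed U) (hconn : ∀ a ∈ U, ∀ b ∈ U, Relation.EqvGen (AdjIn U) a b) {x : I} (hx : x ∈ U)
    (hmin : ∀ z ∈ U, (z ⟶ x) → Nonempty (x ⟶ z))
    (hcomp : ∀ y ∈ notBelow U x, HasCoconeOn F (componentIn (notBelow U x) y)) :
    HasCoconeOn F U := by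
  classical
  have := hI.finite
  let W := notBelow U x
  let R : Setoid W := ⟨fun a b => Relation.EqvGen (AdjIn W) a.1 b.1,
    ⟨fun _ => .refl _, .symm _ _, .trans _ _ _⟩⟩
  have hrep : ∀ q : Quotient R, ∃ y : strictlyAbove U x, Quotient.mk R ⟨y.1, y.2.1⟩ = q := by
    rintro ⟨z⟩
    obtain ⟨y, hy, hyz⟩ := exists_eqvGen_strictlyAbove hconn hx hmin z.2
    exact ⟨⟨y, hy⟩, Quotient.sound hyz⟩
  choose y hy using hrep
  choose A a ha using fun q => hcomp (y q).1 (y q).2.1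
  have hself : ∀ q, (y q).1 ∈ componentIn W (y q).1 := fun q => ⟨(y q).2.1, .refl _⟩
  obtain ⟨D, t, k, hk⟩ := hC.exists_wide A
    (fun q => F.map (y q).2.2.some ≫ a q _ (hself q))
  have hbel : ∀ z ∈ U, z ∉ W → Nonempty (z ⟶ x) := fun z hz hzW =>
    not_isEmpty_iff.1 fun e => hzW ⟨hz, e⟩
  have hmem : ∀ z (hz : z ∈ W), z ∈ componentIn W (y (Quotient.mk R ⟨z, hz⟩)).1 := fun z hz =>
    ⟨hz, Quotient.exact (s := R) (hy _)⟩
  -- Below `x` the arrow to `x` is arbitrary, so `b` is natural only up to eventual equality.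
  let b : ∀ z, z ∈ U → (F.obj z ⟶ D) := fun z hz =>
    if hzW : z ∈ W then a _ z (hmem z hzW) ≫ k _ else F.map (hbel z hz hzW).some ≫ t
  have hb : ∀ q z (hz : z ∈ componentIn W (y q).1), b z hz.1.1 = a q z hz ≫ k q := by
    intro q z hz
    have e : Quotient.mk R ⟨z, hz.1⟩ = q :=
      (Quotient.sound (s := R) (Relation.EqvGen.symm _ _ hz.2)).trans (hy q)
    have e' : ∀ q' (hz' : z ∈ componentIn W (y q').1), q' = q →
        a q' z hz' ≫ k q' = a q z hz ≫ k q := by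
      rintro q' hz' rfl
      rfl
    exact (dif_pos hz.1).trans (e' _ _ e)
  have hb' : ∀ z (hz : z ∈ U) (f : z ⟶ x), EventuallyEq (b z hz) (F.map f ≫ t) := by
    intro z hz f
    have hzW : z ∉ W := fun hzW => hzW.2.false f
    have e : b z hz = F.map (hbel z hz hzW).some ≫ t := dif_neg hzW
    rw [e]
    exact (h.eventuallyEq_map hC F _ _).comp_right t
  refine .of_eventuallyEq hI F hU D b fun z w hz hw f => ?_
  by_cases hwx : Nonempty (w ⟶ x)
  · obtain ⟨g⟩ := hwx
    have e := (hb' w hw g).comp_left (F.map f)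
    rw [← Category.assoc, ← F.map_comp] at e
    exact e.trans (hb' z hz (f ≫ g)).symm
  have hwW : w ∈ W := ⟨hw, not_nonempty_iff.1 hwx⟩
  obtain ⟨q, hq⟩ : ∃ q, w ∈ componentIn W (y q).1 := ⟨_, hmem w hwW⟩
  rw [hb q w hq]
  by_cases hzx : Nonempty (z ⟶ x)
  · obtain ⟨g⟩ := hzx
    obtain ⟨i⟩ := hmin z hz g
    refine EventuallyEq.trans ?_ (hb' z hz g).symm
    rw [← hk q]
    have hw' : w ∈ strictlyAbove U x := ⟨hwW, ⟨i ≫ f⟩⟩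
    -- Since `t` factors through the chosen `y q`, the task is to compare `f` with z ⟶ x ⟶ y q
    -- inside `A q`. The comparison is carried along a zigzag strictly above `x`.
    have key := ((h.eqvGen_strictlyAbove hU hx hmin (y q).2 hw' hq.2).iff_of_invariant
      (P := fun v => ∀ (hv : v ∈ componentIn W (y q).1) (j : z ⟶ v),
        EventuallyEq (F.map f ≫ a q w hq) (F.map j ≫ a q v hv)) ?_).2
        (fun hv j => (h.eventuallyEq_map hC F _ _).comp_right _) (hself q) (g ≫ (y q).2.2.some)
    · simpa only [F.map_comp, Category.assoc] using key.comp_right (k q)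
    · rintro v v' ⟨hv, hv', ⟨l⟩⟩
      have e : ∀ (hvc : v ∈ componentIn W (y q).1) (hvc' : v' ∈ componentIn W (y q).1) (j : z ⟶ v),
          F.map j ≫ a q v hvc = F.map (j ≫ l) ≫ a q v' hvc' := by
        intro hvc hvc' j
        rw [F.map_comp, Category.assoc, ha q v v' hvc hvc' l]
      have hadj : Relation.EqvGen (AdjIn W) v v' := .rel _ _ ⟨hv.1, hv'.1, ⟨l⟩⟩
      constructor
      · intro hP hvc' j
        have hvc : v ∈ componentIn W (y q).1 := ⟨hv.1, .trans _ _ _ hvc'.2 (.symm _ _ hadj)⟩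
        -- The property at `v` is useful only if there is an arrow z ⟶ v; this is why the zigzag
        -- must stay strictly above `x`.
        obtain ⟨m⟩ := hv.2
        have hP' := hP hvc (g ≫ m)
        rw [e hvc hvc'] at hP'
        exact hP'.trans ((h.eventuallyEq_map hC F _ _).comp_right _)
      · intro hP hvc j
        have hvc' : v' ∈ componentIn W (y q).1 := ⟨hv'.1, .trans _ _ _ hvc.2 hadj⟩
        rw [e hvc hvc']
        exact hP hvc' _
  · have hzW : z ∈ W := ⟨hz, not_nonempty_iff.1 hzx⟩
    have hzq : z ∈ componentIn W (y q).1 :=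
      ⟨hzW, .trans _ _ _ hq.2 (.symm _ _ (.rel _ _ ⟨hzW, hwW, ⟨f⟩⟩))⟩
    rw [hb q z hzq, ← Category.assoc, ha q z w hzq hq f]
    exact .refl _

/-- Strong induction on the number of objects of `U`: the components lose `x`. Simple connectedness
is only ever used for the whole of `I`, so it need not pass to `U`. -/
theorem UpwardSimplyConnected.hasCoconeOn (h : UpwardSimplyConnected I)
    (hI : FinitelyGeneratedCategory I) (hC : AmalgamationProperty C) (F : I ⥤ C) (U : Set I)
    (hU : UpClosed U) (hne : U.Nonempty)
    (hconn : ∀ a ∈ U, ∀ b ∈ U, Relation.EqvGen (AdjIn U) a b) : HasCoconeOn F U := by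
  have := hI.finite
  induction hn : U.ncard using Nat.strong_induction_on generalizing U with
  | _ n ih =>
    obtain ⟨x, hx, hmin⟩ := exists_minimal_object hne
    refine h.hasCoconeOn_of_components hI hC F hU hconn hx hmin fun y hy => ?_
    have hW := hU.upClosed_notBelow x
    refine ih _ ?_ _ (hW.upClosed_componentIn y) ⟨y, hy, .refl _⟩
      (fun a ha b hb => eqvGen_componentIn hy ha hb) rfl
    rw [← hn]
    refine Set.ncard_lt_ncard ⟨fun z hz => hz.1.1, fun hsub => ?_⟩ (Set.toFinite U)
    exact (hsub hx).1.2.false (𝟙 x)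

end Cocone

theorem proposition5p7 {I : Type u} [Category.{v} I]
    (hfg : FinitelyGeneratedCategory I) (hconn : CategoryTheory.IsConnected I) (husc : UpwardSimplyConnected I)
    {C : Type u'} [Category.{v'} C] (hC : AmalgamationProperty C) (F : I ⥤ C) :
    Nonempty (Limits.Cocone F) := by
  have hzz : ∀ a b : I, Relation.EqvGen (AdjIn (Set.univ : Set I)) a b := by
    intro a b
    induction isPreconnected_zigzag a b with
    | refl => exact .refl _
    | tail _ hz ih =>
      refine .trans _ _ _ ih ?_
      obtain hf | hf := hz
      · exact .rel _ _ ⟨trivial, trivial, hf⟩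
      · exact .symm _ _ (.rel _ _ ⟨trivial, trivial, hf⟩)
  obtain ⟨A, a, ha⟩ := husc.hasCoconeOn hfg hC F Set.univ (fun _ _ _ _ => trivial)
    Set.univ_nonempty (fun a _ b _ => hzz a b)
  exact ⟨⟨A, { app := fun z => a z trivial
               naturality := fun z w f => by simpa using ha z w trivial trivial f }⟩⟩
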